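/- A metric space $X$ is *straight* if, whenever $X$ is the union of finitely many closed sets, a continuous function $f\colon X\to\mathbb{R}$ is uniformly continuous if and only if its restriction to each of these closed sets is uniformly continuous. It is *uniformly locally connected* (ULC) if for every $\varepsilon>0$ there is $\delta>0$ such that any two points at distance $<\delta$ lie in a connected set of diameter $<\varepsilon$. It is *precompact* if it is totally bounded. Let $X_1,\dots,X_n$ be non-empty metric spaces, and let $X=\prod_{i=1}^n X_i$ carry the metric $d(x,y)=\sum_{i=1}^n d_i(x_i,y_i)$. Then $X$ is straight if and only if all the spaces $X_i$ are straight and at least one of the following conditions holds: (a) all spaces $X_i$ are precompact; (b) all spaces $X_i$ are ULC; (c) there is an index $j$ such that $X_i$ is both precompact and ULC for every $i\neq j$. -/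

import Mathlib

/-- A metric space `X` is *straight* if, whenever `X` is the union of finitely many closed sets,
a continuous function `f : X → ℝ` is uniformly continuous if and only if its restriction to each
of the closed sets is uniformly continuous. -/
def IsStraight (X : Type*) [MetricSpace X] : Prop :=
  ∀ (m : ℕ) (C : Fin m → Set X), (∀ k, IsClosed (C k)) → (⋃ k, C k) = Set.univ →
    ∀ f : C(X, ℝ), UniformContinuous f ↔ ∀ k, UniformContinuousOn f (C k)

/-- A metric space `X` is *uniformly locally connected* if for every `ε > 0` there is `δ > 0` such
that any two points at distance `< δ` lie in a connected set of diameter `< ε`. The diameter is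
the extended one, so that unbounded sets have infinite diameter. -/
def IsULC (X : Type*) [MetricSpace X] : Prop :=
  ∀ ε : ℝ, 0 < ε → ∃ δ : ℝ, 0 < δ ∧ ∀ x y : X, dist x y < δ →
    ∃ C : Set X, IsConnected C ∧ x ∈ C ∧ y ∈ C ∧ Metric.ediam C < ENNReal.ofReal ε

/-- A metric space is *precompact* if it is totally bounded. -/
def IsPrecompactSpace (X : Type*) [MetricSpace X] : Prop :=
  TotallyBounded (Set.univ : Set X)

/-! Straightness amounts to two conditions. One is local in the completion: each neighbourhood
filter of a completion point has a tight trace (`IsStraight.isTight_completionTrace`). The other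
concerns infinity: in a sequence of ever closer pairs, those separated in balls of a fixed radius
form a totally bounded set (`IsStraight.hasTotallyBoundedSeparation`). The converse is
`IsStraight.of_isTight`.

Tightness passes to finite products at no cost (`IsTight.prod`), because a countably generated
filter deciding every set is principal. Only the second condition can fail. Close pairs separated in
the product are separated in one coordinate `j`, and they can escape total boundedness through
another coordinate `i` exactly when `X i` is not precompact and `X j` is not ULC. Thus the criterion
is: for all `i ≠ j`, `X i` is precompact or `X j` is ULC. By `forall_ne_or_iff` this is the
disjunction of (a), (b), (c). -/

open Filter Topology Set

/-! ### Tight filters and their finite products. -/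

/-- A filter with a basis of open sets which is not split by any pair of disjoint open sets. -/
structure IsTight {Y : Type*} [TopologicalSpace Y] (G : Filter Y) : Prop where
  interior_mem : ∀ s ∈ G, interior s ∈ G
  split : ∀ U V : Set Y, IsOpen U → IsOpen V → Disjoint U V → U ∪ V ∈ G → U ∈ G ∨ V ∈ G

/-- A countably generated ultrafilter is principal. -/
theorem exists_singleton_mem_of_forall_mem_or_compl_mem {α : Type*} {H : Filter α} [H.NeBot]
    [H.IsCountablyGenerated] (h : ∀ S : Set α, S ∈ H ∨ Sᶜ ∈ H) : ∃ a, {a} ∈ H := by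
  by_contra! hne
  have hc : ∀ a, ({a} : Set α)ᶜ ∈ H := fun a => (h {a}).resolve_left (hne a)
  obtain ⟨u, hu⟩ := H.exists_seq_tendsto
  have hlater : ∀ n, ∃ N, n < N ∧ ∀ m ≥ N, u m ≠ u n := by
    intro n
    obtain ⟨N, hN⟩ := eventually_atTop.1 (hu (hc (u n)))
    exact ⟨max N (n + 1), by omega, fun m hm => hN m (le_trans (le_max_left _ _) hm)⟩
  choose N hnN hN using hlater
  let κ : ℕ → ℕ := fun k => N^[k] 0
  have hκs : ∀ k, κ (k + 1) = N (κ k) := fun k => Function.iterate_succ_apply' N k 0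
  have hκ : StrictMono κ := strictMono_nat_of_lt_succ fun k => by rw [hκs]; exact hnN _
  have hinj : ∀ k l, k < l → u (κ l) ≠ u (κ k) := fun k l hkl =>
    hN _ _ (by rw [← hκs]; exact hκ.monotone hkl)
  have hdist : ∀ k l, u (κ k) = u (κ l) → k = l := by
    intro k l hkl
    rcases lt_trichotomy k l with h | h | h
    · exact absurd hkl.symm (hinj k l h)
    · exact h
    · exact absurd hkl (hinj l k h)
  have hlim : Tendsto (fun k => u (κ k)) atTop H := hu.comp hκ.tendsto_atTop
  -- The terms `u (κ k)` are distinct and tend to `H`, yet visit the even-indexed terms and their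
  -- complement infinitely often.
  rcases h (range fun k => u (κ (2 * k))) with hS | hS
  · obtain ⟨K, hK⟩ := eventually_atTop.1 (hlim hS)
    obtain ⟨l, hl⟩ := hK (2 * K + 1) (by omega)
    have := hdist _ _ hl
    omega
  · obtain ⟨K, hK⟩ := eventually_atTop.1 (hlim hS)
    exact hK (2 * K) (by omega) ⟨K, rfl⟩

/-- A map which is locally constant at almost every point is eventually constant along a tight
filter. -/
theorem IsTight.eventually_const {Y α : Type*} [TopologicalSpace Y] {G : Filter Y} [G.NeBot]
    [G.IsCountablyGenerated] (hG : IsTight G) {T : Y → α}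
    (hT : ∀ᶠ y in G, ∀ᶠ y' in 𝓝 y, T y' = T y) : ∃ a, ∀ᶠ y in G, T y = a := by
  refine exists_singleton_mem_of_forall_mem_or_compl_mem (H := map T G) fun S => ?_
  have hd : Disjoint (interior (T ⁻¹' S)) (interior (T ⁻¹' Sᶜ)) :=
    (disjoint_compl_right (a := T ⁻¹' S)).mono interior_subset interior_subset
  suffices hcov : interior (T ⁻¹' S) ∪ interior (T ⁻¹' Sᶜ) ∈ G from
    (hG.split _ _ isOpen_interior isOpen_interior hd hcov).imp
      (fun h => mem_map.2 (mem_of_superset h interior_subset))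
      (fun h => mem_map.2 (mem_of_superset h interior_subset))
  filter_upwards [hT] with y hy
  by_cases hyS : T y ∈ S
  · left
    rw [mem_interior_iff_mem_nhds]
    filter_upwards [hy] with y' h
    simpa [h] using hyS
  · right
    rw [mem_interior_iff_mem_nhds]
    filter_upwards [hy] with y' h
    simpa [h] using hyS

section Prod

variable {X Y : Type*} [TopologicalSpace X] [TopologicalSpace Y]

/-- Otherwise a sequence in `V` tends to `F ×ˢ G`. Recording which of its first coordinates put `y`
in `V` gives a locally constant function of `y`, hence one constant along `G`. Its value is a
bounded set of indices, yet the sequence forces arbitrarily large ones into it. -/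
theorem IsTight.mem_prod_of_eventually_mem {F : Filter X} {G : Filter Y} [F.IsCountablyGenerated]
    [G.NeBot] [G.IsCountablyGenerated] (hG : IsTight G) {U V : Set (X × Y)} (hU : IsOpen U)
    (hV : IsOpen V) (hd : Disjoint U V) (hUV : U ∪ V ∈ F ×ˢ G)
    (hl : ∀ᶠ y in G, U ∈ F ×ˢ 𝓝 y) : U ∈ F ×ˢ G := by
  by_contra hn
  obtain ⟨A, hA, B, hB, hAB⟩ := mem_prod_iff.1 hUV
  have hfr : ∃ᶠ q in F ×ˢ G, q ∉ U ∧ q ∈ A ×ˢ B := by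
    refine Frequently.and_eventually ?_ (prod_mem_prod hA hB)
    exact fun h => hn (by filter_upwards [h] with q hq using not_not.1 hq)
  obtain ⟨q, hq, hqU⟩ := exists_seq_forall_of_frequently hfr
  have hqF : Tendsto (fun k => (q k).1) atTop F := tendsto_fst.comp hq
  have hqG : Tendsto (fun k => (q k).2) atTop G := tendsto_snd.comp hq
  have hqV : ∀ k, q k ∈ V := fun k => (hAB (hqU k).2).resolve_left (hqU k).1
  let T : Y → Set ℕ := fun y => {k | ((q k).1, y) ∈ V}
  have key : ∀ᶠ y in G, ∃ K, ∀ᶠ y' in 𝓝 y, ∀ k ≥ K, k ∉ T y' := by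
    filter_upwards [hl] with y hy
    obtain ⟨A', hA', W, hW, hAW⟩ := mem_prod_iff.1 hy
    obtain ⟨K, hK⟩ := eventually_atTop.1 (hqF hA')
    refine ⟨K, ?_⟩
    filter_upwards [hW] with y' hy' k hk hkT
    exact disjoint_left.1 hd (hAW (mk_mem_prod (hK k hk) hy')) hkT
  have hloc : ∀ᶠ y in G, ∀ᶠ y' in 𝓝 y, T y' = T y := by
    filter_upwards [key, hB] with y ⟨K, hK⟩ hyB
    -- Each of the finitely many indices below `K` is locally decided, since `U` and `V` are open
    -- and cover the slice over `B`.
    have hsmall : ∀ᶠ y' in 𝓝 y, ∀ k ∈ Finset.range K, (k ∈ T y' ↔ k ∈ T y) := by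
      rw [eventually_all_finset]
      intro k _
      have hc : Continuous fun y' : Y => ((q k).1, y') := by fun_prop
      rcases hAB (mk_mem_prod (hqU k).2.1 hyB) with h | h
      · filter_upwards [(hU.preimage hc).mem_nhds h] with y' hy'
        exact iff_of_false (fun h' => disjoint_left.1 hd hy' h')
          (fun h' => disjoint_left.1 hd h h')
      · filter_upwards [(hV.preimage hc).mem_nhds h] with y' hy'
        exact iff_of_true hy' h
    filter_upwards [hK, hsmall] with y' h1 h2
    ext k
    rcases lt_or_ge k K with hk | hk
    · exact h2 k (Finset.mem_range.2 hk)
    · exact iff_of_false (h1 k hk) (hK.self_of_nhds k hk)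
  obtain ⟨T₀, hT₀⟩ := hG.eventually_const hloc
  obtain ⟨y, ⟨K, hK⟩, hyT⟩ := (key.and hT₀).exists
  obtain ⟨k, hkT, hkK⟩ := ((hqG.eventually hT₀).and (eventually_ge_atTop K)).exists
  have hk : k ∈ T (q k).2 := hqV k
  rw [hkT, ← hyT] at hk
  exact hK.self_of_nhds k hkK hk

theorem interior_mem_prod {F : Filter X} {G : Filter Y} (hF : ∀ s ∈ F, interior s ∈ F)
    (hG : ∀ s ∈ G, interior s ∈ G) : ∀ s ∈ F ×ˢ G, interior s ∈ F ×ˢ G := by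
  intro s hs
  obtain ⟨A, hA, B, hB, hAB⟩ := mem_prod_iff.1 hs
  refine mem_of_superset (prod_mem_prod (hF A hA) (hG B hB)) ?_
  rw [← interior_prod_eq]
  exact interior_mono hAB

/-- The slice over `x` decides which of the two sets wins. -/
theorem IsTight.nhds_prod [FirstCountableTopology X] {G : Filter Y} [G.NeBot]
    [G.IsCountablyGenerated] (hG : IsTight G) (x : X) {U V : Set (X × Y)} (hU : IsOpen U)
    (hV : IsOpen V) (hd : Disjoint U V) (hUV : U ∪ V ∈ 𝓝 x ×ˢ G) :
    U ∈ 𝓝 x ×ˢ G ∨ V ∈ 𝓝 x ×ˢ G := by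
  obtain ⟨A, hA, B, hB, hAB⟩ := mem_prod_iff.1 hUV
  have hc : Continuous fun y : Y => (x, y) := by fun_prop
  have hslice : ∀ W : Set (X × Y), IsOpen W → (fun y : Y => (x, y)) ⁻¹' W ∈ G →
      ∀ᶠ y in G, W ∈ 𝓝 x ×ˢ 𝓝 y := by
    intro W hW h
    filter_upwards [h] with y hy
    rw [← nhds_prod_eq]
    exact hW.mem_nhds hy
  rcases hG.split _ _ (hU.preimage hc) (hV.preimage hc) (hd.preimage _)
    (mem_of_superset hB fun y hy => hAB (mk_mem_prod (mem_of_mem_nhds hA) hy)) with h | h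
  · exact Or.inl (hG.mem_prod_of_eventually_mem hU hV hd hUV (hslice U hU h))
  · exact Or.inr (hG.mem_prod_of_eventually_mem hV hU hd.symm (union_comm U V ▸ hUV)
      (hslice V hV h))

theorem IsTight.prod_nhds [FirstCountableTopology Y] {F : Filter X} [F.NeBot]
    [F.IsCountablyGenerated] (hF : IsTight F) (y : Y) {U V : Set (X × Y)} (hU : IsOpen U)
    (hV : IsOpen V) (hd : Disjoint U V) (hUV : U ∪ V ∈ F ×ˢ 𝓝 y) :
    U ∈ F ×ˢ 𝓝 y ∨ V ∈ F ×ˢ 𝓝 y := by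
  rw [prod_comm] at hUV ⊢
  exact hF.nhds_prod y (hU.preimage continuous_swap) (hV.preimage continuous_swap)
    (hd.preimage _) hUV

/-- Almost every `y` chooses `U` or `V` along `F ×ˢ 𝓝 y`. The two sets of choices are open and
disjoint, so `G` selects one. -/
theorem IsTight.prod [FirstCountableTopology Y] {F : Filter X} {G : Filter Y} [F.NeBot]
    [F.IsCountablyGenerated] [G.NeBot] [G.IsCountablyGenerated] (hF : IsTight F)
    (hG : IsTight G) : IsTight (F ×ˢ G) where
  interior_mem := interior_mem_prod hF.interior_mem hG.interior_mem
  split := by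
    intro U V hU hV hd hUV
    have hopen : ∀ W : Set (X × Y), IsOpen {y | W ∈ F ×ˢ 𝓝 y} := by
      refine fun W => isOpen_iff_mem_nhds.2 fun y hy => ?_
      obtain ⟨A, hA, B, hB, hAB⟩ := mem_prod_iff.1 hy
      filter_upwards [eventually_mem_nhds_iff.2 hB] with y' hy'
      exact mem_of_superset (prod_mem_prod hA hy') hAB
    have hdis : Disjoint {y | U ∈ F ×ˢ 𝓝 y} {y | V ∈ F ×ˢ 𝓝 y} := by
      refine disjoint_left.2 fun y h1 h2 => ?_
      obtain ⟨z, hz1, hz2⟩ := Filter.nonempty_of_mem (inter_mem (id h1 : U ∈ F ×ˢ 𝓝 y) (id h2 : V ∈ F ×ˢ 𝓝 y))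
      exact disjoint_left.1 hd hz1 hz2
    have hcov : {y | U ∈ F ×ˢ 𝓝 y} ∪ {y | V ∈ F ×ˢ 𝓝 y} ∈ G := by
      obtain ⟨A, hA, B, hB, hAB⟩ := mem_prod_iff.1 hUV
      filter_upwards [hG.interior_mem B hB] with y hy
      exact hF.prod_nhds y hU hV hd
        (mem_of_superset (prod_mem_prod hA (mem_interior_iff_mem_nhds.1 hy)) hAB)
    rcases hG.split _ _ (hopen U) (hopen V) hdis hcov with h | h
    · exact Or.inl (hG.mem_prod_of_eventually_mem hU hV hd hUV h)
    · exact Or.inr (hG.mem_prod_of_eventually_mem hV hU hd.symm (union_comm U V ▸ hUV) h)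

theorem IsTight.map_homeomorph {F : Filter X} (hF : IsTight F) (e : X ≃ₜ Y) :
    IsTight (map e F) where
  interior_mem s hs := by
    rw [mem_map, e.preimage_interior]
    exact hF.interior_mem _ hs
  split U V hU hV hd h :=
    hF.split _ _ (hU.preimage e.continuous) (hV.preimage e.continuous) (hd.preimage _) h

end Prod

theorem isTight_of_subsingleton {Y : Type*} [TopologicalSpace Y] [Subsingleton Y] (G : Filter Y)
    [G.NeBot] : IsTight G := by
  obtain ⟨y, -⟩ := G.nonempty_of_mem univ_mem
  have huniv : ∀ s : Set Y, y ∈ s → s = univ := fun s h =>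
    eq_univ_of_forall fun z => Subsingleton.elim y z ▸ h
  refine ⟨fun s hs => ?_, fun U V _ _ _ h => ?_⟩
  · rwa [(isOpen_discrete s).interior_eq]
  · obtain ⟨z, hz⟩ := G.nonempty_of_mem h
    rw [Subsingleton.elim z y] at hz
    exact hz.imp (fun h => huniv U h ▸ univ_mem) (fun h => huniv V h ▸ univ_mem)

/-- `Fin.cons` as a homeomorphism. -/
def finConsHomeomorph {n : ℕ} (X : Fin (n + 1) → Type*) [∀ i, TopologicalSpace (X i)] :
    (X 0 × ∀ i : Fin n, X i.succ) ≃ₜ ∀ i, X i where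
  toEquiv := Fin.consEquiv X
  continuous_toFun := by
    refine continuous_pi fun i => ?_
    refine Fin.cases ?_ (fun i => ?_) i
    · exact continuous_fst
    · exact (continuous_apply i).comp continuous_snd
  continuous_invFun := (continuous_apply 0).prodMk (continuous_pi fun i => continuous_apply i.succ)

theorem map_finConsHomeomorph_prod_pi {n : ℕ} {X : Fin (n + 1) → Type*}
    [∀ i, TopologicalSpace (X i)] (F : ∀ i, Filter (X i)) :
    map (finConsHomeomorph X) (F 0 ×ˢ pi fun i : Fin n => F i.succ) = pi F := by
  apply le_antisymm
  · refine le_pi.2 fun i => ?_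
    refine Fin.cases ?_ (fun i => ?_) i
    · exact tendsto_map'_iff.2 tendsto_fst
    · exact tendsto_map'_iff.2 ((tendsto_eval_pi _ i).comp tendsto_snd)
  · have h : Tendsto (finConsHomeomorph X).symm (pi F) (F 0 ×ˢ pi fun i : Fin n => F i.succ) :=
      (tendsto_eval_pi F 0).prodMk (tendsto_pi.2 fun i => tendsto_eval_pi F i.succ)
    have := map_mono (m := finConsHomeomorph X) h
    rwa [map_map, Homeomorph.self_comp_symm, map_id] at this

theorem IsTight.pi {n : ℕ} {X : Fin n → Type*} [∀ i, TopologicalSpace (X i)]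
    [∀ i, FirstCountableTopology (X i)] {F : ∀ i, Filter (X i)} [∀ i, (F i).NeBot]
    [∀ i, (F i).IsCountablyGenerated] (hF : ∀ i, IsTight (F i)) : IsTight (Filter.pi F) := by
  induction n with
  | zero => exact isTight_of_subsingleton _
  | succ n ih =>
    rw [← map_finConsHomeomorph_prod_pi]
    exact ((hF 0).prod (ih fun i => hF i.succ)).map_homeomorph _

/-! ### Separation in balls and uniform local connectedness. -/

/-- Some partition of the open ball of radius `r` around `x` into two disjoint open sets separates
`x` from `y`. -/
def IsBallSeparated {X : Type*} [MetricSpace X] (r : ℝ) (x y : X) : Prop :=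
  ∃ U V : Set X, IsOpen U ∧ IsOpen V ∧ Disjoint U V ∧ Metric.ball x r ⊆ U ∪ V ∧ x ∈ U ∧ y ∈ V

section ULC

variable {X : Type*} [MetricSpace X]

/-- A connected set of diameter less than `r` containing both points lies in the ball, and no
partition splits it. -/
theorem IsULC.exists_not_isBallSeparated (h : IsULC X) {r : ℝ} (hr : 0 < r) :
    ∃ δ > 0, ∀ x y : X, dist x y < δ → ¬ IsBallSeparated r x y := by
  obtain ⟨δ, hδ, H⟩ := h r hr
  refine ⟨δ, hδ, fun x y hxy ⟨U, V, hU, hV, hd, hUV, hxU, hyV⟩ => ?_⟩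
  obtain ⟨C, hC, hxC, hyC, hdiam⟩ := H x y hxy
  have hball : C ⊆ Metric.ball x r := fun z hz => by
    have := (Metric.edist_le_ediam_of_mem hz hxC).trans_lt hdiam
    rwa [edist_dist, ENNReal.ofReal_lt_ofReal_iff hr] at this
  obtain ⟨z, -, hzU, hzV⟩ := hC.isPreconnected U V hU hV (hball.trans hUV) ⟨x, hxC, hxU⟩
    ⟨y, hyC, hyV⟩
  exact disjoint_left.1 hd hzU hzV

/-- If close points are never separated in small balls, then quasicomponents of open balls are open
and hence connected. -/
theorem IsULC.of_not_isBallSeparated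
    (h : ∀ r > 0, ∃ δ > 0, ∀ x y : X, dist x y < δ → ¬ IsBallSeparated r x y) : IsULC X := by
  intro ε hε
  have hr : 0 < ε / 3 := by positivity
  obtain ⟨δ, hδ, H⟩ := h (ε / 3) hr
  refine ⟨min δ (ε / 3), lt_min hδ hr, fun x y hxy => ?_⟩
  let B := Metric.ball x (ε / 3)
  let Q : Set X := {z | z ∈ B ∧ ∀ U V : Set X, IsOpen U → IsOpen V → Disjoint U V → B ⊆ U ∪ V →
    x ∈ U → z ∈ U}
  have hxB : x ∈ B := Metric.mem_ball_self hr
  have hxQ : x ∈ Q := ⟨hxB, fun _ _ _ _ _ _ hx => hx⟩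
  have hQB : Q ⊆ B := fun z hz => hz.1
  have hyQ : y ∈ Q := by
    have hyB : y ∈ B := by
      rw [Metric.mem_ball, dist_comm]
      exact hxy.trans_le (min_le_right _ _)
    refine ⟨hyB, fun U V hU hV hd hUV hxU => ?_⟩
    by_contra hyU
    exact H x y (hxy.trans_le (min_le_left _ _))
      ⟨U, V, hU, hV, hd, hUV, hxU, (hUV hyB).resolve_left hyU⟩
  -- A point near `z ∈ Q` but outside `Q` would be separated from `z` in a ball contained in `B`.
  have hQo : IsOpen Q := by
    rw [Metric.isOpen_iff]
    intro z hz
    obtain ⟨ρ, hρ, hzρ⟩ := Metric.isOpen_iff.1 Metric.isOpen_ball z hz.1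
    obtain ⟨δ', hδ', H'⟩ := h ρ hρ
    refine ⟨min δ' ρ, lt_min hδ' hρ, fun w hw => ?_⟩
    rw [Metric.mem_ball, lt_min_iff] at hw
    have hwB : w ∈ B := hzρ hw.2
    refine ⟨hwB, fun U V hU hV hd hUV hxU => ?_⟩
    by_contra hwU
    exact H' z w (by rw [dist_comm]; exact hw.1)
      ⟨U, V, hU, hV, hd, hzρ.trans hUV, hz.2 U V hU hV hd hUV hxU, (hUV hwB).resolve_left hwU⟩
  have hQc : IsOpen (B \ Q) := by
    rw [isOpen_iff_mem_nhds]
    rintro z ⟨hzB, hzQ⟩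
    have : ∃ U V : Set X, IsOpen U ∧ IsOpen V ∧ Disjoint U V ∧ B ⊆ U ∪ V ∧ x ∈ U ∧ z ∉ U := by
      by_contra! hcon
      exact hzQ ⟨hzB, hcon⟩
    obtain ⟨U, V, hU, hV, hd, hUV, hxU, hzU⟩ := this
    filter_upwards [hV.mem_nhds ((hUV hzB).resolve_left hzU), Metric.isOpen_ball.mem_nhds hzB]
      with w hwV hwB
    exact ⟨hwB, fun hwQ => disjoint_left.1 hd (hwQ.2 U V hU hV hd hUV hxU) hwV⟩
  have hside : ∀ U V : Set X, IsOpen U → IsOpen V → Q ⊆ U ∪ V → Q ∩ (U ∩ V) = ∅ → x ∈ U →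
      Q ⊆ U := by
    intro U V hU hV hUV hd hxU z hz
    -- As `Q` is clopen in `B`, a partition of `Q` extends to `B` by adding `B \ Q` to the side
    -- without `x`.
    refine (hz.2 (U ∩ Q) (V ∩ Q ∪ B \ Q) (hU.inter hQo) ((hV.inter hQo).union hQc) ?_ ?_
      ⟨hxU, hxQ⟩).1
    · refine disjoint_left.2 ?_
      rintro w ⟨hwU, hwQ⟩ (⟨hwV, -⟩ | ⟨-, hw⟩)
      · exact notMem_empty w (hd ▸ ⟨hwQ, hwU, hwV⟩)
      · exact hw hwQ
    · intro w hwB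
      by_cases hwQ : w ∈ Q
      · exact (hUV hwQ).imp (fun h => ⟨h, hwQ⟩) (fun h => Or.inl ⟨h, hwQ⟩)
      · exact Or.inr (Or.inr ⟨hwB, hwQ⟩)
  have hconn : IsPreconnected Q := by
    rw [isPreconnected_iff_subset_of_disjoint]
    intro U V hU hV hUV hd
    rcases hUV hxQ with hx | hx
    · exact Or.inl (hside U V hU hV hUV hd hx)
    · exact Or.inr (hside V U hV hU (union_comm U V ▸ hUV) (inter_comm U V ▸ hd) hx)
  refine ⟨Q, ⟨⟨x, hxQ⟩, hconn⟩, hxQ, hyQ, ?_⟩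
  refine (Metric.ediam_le (d := ENNReal.ofReal (2 * (ε / 3))) fun z hz w hw => ?_).trans_lt
    ((ENNReal.ofReal_lt_ofReal_iff hε).2 (by linarith))
  rw [edist_dist]
  refine ENNReal.ofReal_le_ofReal ?_
  have h1 : dist z x < ε / 3 := hQB hz
  have h2 : dist w x < ε / 3 := hQB hw
  linarith [dist_triangle_right z w x]

end ULC

/-! ### Separated sequences and total boundedness. -/

section TotallyBounded

variable {X : Type*} [MetricSpace X]

theorem exists_seq_of_not_totallyBounded {s : Set X} (h : ¬ TotallyBounded s) :
    ∃ ε > 0, ∃ u : ℕ → X, (∀ n, u n ∈ s) ∧ ∀ m n, m ≠ n → ε ≤ dist (u m) (u n) := by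
  rw [Metric.totallyBounded_iff] at h
  push Not at h
  obtain ⟨ε, hε, H⟩ := h
  obtain ⟨u, hu⟩ : ∃ u : ℕ → X, ∀ n, u n ∈ s ∧ ∀ m < n, ε ≤ dist (u n) (u m) := by
    obtain ⟨u, hu⟩ := seq_of_forall_finite_exists
      (P := fun (x : X) (t : Set X) => x ∈ s ∧ ∀ y ∈ t, ε ≤ dist x y) fun t ht => by
        obtain ⟨x, hx, hxt⟩ := not_subset.1 (H t ht)
        simp only [mem_iUnion, Metric.mem_ball, not_exists, not_lt] at hxt
        exact ⟨x, hx, hxt⟩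
    exact ⟨u, fun n => ⟨(hu n).1, fun m hm => (hu n).2 _ ⟨m, hm, rfl⟩⟩⟩
  refine ⟨ε, hε, u, fun n => (hu n).1, fun m n hmn => ?_⟩
  rcases lt_or_gt_of_ne hmn with h | h
  · rw [dist_comm]
    exact (hu n).2 m h
  · exact (hu m).2 n h

/-- A sequence with totally bounded range is Cauchy along any nonprincipal ultrafilter. -/
theorem cauchy_map_hyperfilter {u : ℕ → X} (h : TotallyBounded (range u)) :
    Cauchy (map u (hyperfilter ℕ : Filter ℕ)) :=
  ((hyperfilter ℕ).map u).cauchy_of_totallyBounded h (le_principal_iff.2 range_mem_map)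

theorem not_totallyBounded_range {u : ℕ → X} {ε : ℝ} (hε : 0 < ε)
    (hu : ∀ m n, m ≠ n → ε ≤ dist (u m) (u n)) : ¬ TotallyBounded (range u) := by
  intro h
  obtain ⟨-, H⟩ := Metric.cauchy_iff.1 (cauchy_map_hyperfilter h)
  obtain ⟨t, ht, hdist⟩ := H ε hε
  have hinf : (u ⁻¹' t).Infinite := fun hfin => by
    have := (hyperfilter ℕ).compl_notMem_iff.2 ht
    exact this (hfin.compl_mem_hyperfilter)
  obtain ⟨m, hm, n, hn, hmn⟩ := hinf.nontrivial
  exact absurd (hdist _ hm _ hn) (not_lt.2 (hu m n hmn))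

end TotallyBounded

/-! ### Characterization of straight spaces. -/

section Straight

variable {X : Type*} [MetricSpace X]

/-- In a straight space, two disjoint open sets covering a sublevel set `{g < r}` of a 1-Lipschitz
function stay at a positive distance from each other on a smaller sublevel set. -/
theorem IsStraight.exists_le_dist (h : IsStraight X) {g : X → ℝ} (hg : LipschitzWith 1 g) {r : ℝ}
    (hr : 0 < r) {U V : Set X} (hU : IsOpen U) (hV : IsOpen V) (hd : Disjoint U V)
    (hUV : {z | g z < r} ⊆ U ∪ V) :
    ∃ δ > 0, ∀ z ∈ U, ∀ w ∈ V, g z < δ → δ ≤ dist z w := by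
  have hgc : Continuous g := hg.continuous
  -- A bump on `U` that dies out at level `r / 2`, before leaving the region where `U` and `V` form
  -- a partition; hence it is continuous.
  let f : X → ℝ := U.indicator fun z => max 0 (r / 2 - g z)
  have hfV : ∀ z ∈ V, f z = 0 := fun z hz =>
    indicator_of_notMem (fun hzU => disjoint_left.1 hd hzU hz) _
  have hfg : ∀ z, r / 2 ≤ g z → f z = 0 := fun z hz => by
    by_cases hzU : z ∈ U
    · exact (indicator_of_mem hzU _).trans (max_eq_left (by linarith))
    · exact indicator_of_notMem hzU _
  have hfU : ∀ z ∈ U, f z = max 0 (r / 2 - g z) := fun z hz => indicator_of_mem hz _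
  have hfc : Continuous f := by
    refine continuous_iff_continuousAt.2 fun z => ?_
    rcases lt_or_ge (g z) r with hz | hz
    · rcases hUV hz with hz | hz
      · refine (ContinuousAt.congr (f := fun z => max 0 (r / 2 - g z)) (by fun_prop) ?_)
        filter_upwards [hU.mem_nhds hz] with w hw
        exact (hfU w hw).symm
      · refine (continuousAt_const (y := (0 : ℝ))).congr ?_
        filter_upwards [hV.mem_nhds hz] with w hw
        exact (hfV w hw).symm
    · refine (continuousAt_const (y := (0 : ℝ))).congr ?_
      filter_upwards [hgc.continuousAt.eventually (lt_mem_nhds (show r / 2 < g z by linarith))]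
        with w hw
      exact (hfg w hw.le).symm
  -- On the first closed set `f` vanishes; on the second it equals the Lipschitz function `max 0 (r
  -- / 2 - g)`.
  let C : Fin 2 → Set X := ![(U ∩ {z | g z < r / 2})ᶜ, (V ∪ {z | r / 2 < g z})ᶜ]
  have hC : ∀ k, IsClosed (C k) := by
    intro k
    fin_cases k
    · exact (hU.inter (isOpen_lt hgc continuous_const)).isClosed_compl
    · exact (hV.union (isOpen_lt continuous_const hgc)).isClosed_compl
  have hCU : ⋃ k, C k = univ := by
    refine eq_univ_of_forall fun z => mem_iUnion.2 ?_
    by_cases hz : z ∈ U ∩ {z | g z < r / 2}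
    · refine ⟨1, ?_⟩
      rintro (hzV | hzg)
      · exact disjoint_left.1 hd hz.1 hzV
      · exact lt_asymm (id hz.2 : g z < r / 2) hzg
    · exact ⟨0, hz⟩
  have hf0 : ∀ z ∈ C 0, f z = 0 := fun z hz => by
    by_cases hzU : z ∈ U
    · exact hfg z (not_lt.1 fun hzg => hz ⟨hzU, hzg⟩)
    · exact indicator_of_notMem hzU _
  have hf1 : ∀ z ∈ C 1, f z = max 0 (r / 2 - g z) := fun z hz => by
    have hz' : z ∉ V ∧ g z ≤ r / 2 :=
      ⟨fun h => hz (Or.inl h), not_lt.1 fun h => hz (Or.inr h)⟩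
    exact hfU z ((hUV (show g z < r by linarith)).resolve_right hz'.1)
  have hgu : UniformContinuous fun z => max 0 (r / 2 - g z) :=
    (LipschitzWith.id.const_max 0).uniformContinuous.comp
      (uniformContinuous_const.sub hg.uniformContinuous)
  have huc : UniformContinuous f := by
    refine (h 2 C hC hCU ⟨f, hfc⟩).2 fun k => ?_
    fin_cases k
    · exact (uniformContinuous_const (b := (0 : ℝ))).uniformContinuousOn.congr
        fun z hz => (hf0 z hz).symm
    · exact hgu.uniformContinuousOn.congr fun z hz => (hf1 z hz).symm
  obtain ⟨δ, hδ, H⟩ := Metric.uniformContinuous_iff.1 huc (r / 4) (by positivity)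
  refine ⟨min δ (r / 4), by positivity, fun z hz w hw hgz => ?_⟩
  by_contra! hdist
  have h1 := H (hdist.trans_le (min_le_left _ _))
  rw [hfV w hw, hfU z hz, Real.dist_eq, sub_zero] at h1
  have h2 := (le_max_right 0 (r / 2 - g z)).trans (le_abs_self _)
  have h3 := hgz.trans_le (min_le_right _ _)
  linarith

/-- The trace on `X` of the neighbourhood filter of a point of the completion. -/
abbrev completionTrace (p : UniformSpace.Completion X) : Filter X :=
  comap ((↑) : X → UniformSpace.Completion X) (𝓝 p)

theorem completionTrace_hasBasis (p : UniformSpace.Completion X) :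
    (completionTrace p).HasBasis (fun ε : ℝ => 0 < ε) fun ε =>
      {z | dist (z : UniformSpace.Completion X) p < ε} :=
  Metric.nhds_basis_ball.comap _

instance completionTrace_neBot (p : UniformSpace.Completion X) : (completionTrace p).NeBot :=
  UniformSpace.Completion.isDenseInducing_coe.comap_nhds_neBot p

theorem lipschitzWith_dist_completion (p : UniformSpace.Completion X) :
    LipschitzWith 1 fun z : X => dist (z : UniformSpace.Completion X) p := by
  refine LipschitzWith.of_dist_le_mul fun z w => ?_
  rw [NNReal.coe_one, one_mul, Real.dist_eq, ← UniformSpace.Completion.dist_eq z w]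
  exact abs_dist_sub_le _ _ _

/-- If neither set belonged to the trace, both would contain points arbitrarily near `p`, hence near
each other, against `IsStraight.exists_le_dist` for the distance to `p`. -/
theorem IsStraight.isTight_completionTrace (h : IsStraight X) (p : UniformSpace.Completion X) :
    IsTight (completionTrace p) where
  interior_mem s hs := by
    obtain ⟨t, ht, hts⟩ := mem_comap.1 hs
    refine mem_of_superset (preimage_mem_comap (interior_mem_nhds.2 ht)) ?_
    exact interior_maximal ((preimage_mono interior_subset).trans hts)
      (isOpen_interior.preimage (UniformSpace.Completion.continuous_coe X))
  split U V hU hV hd hUV := by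
    by_contra! hn
    obtain ⟨r, hr, hsub⟩ := (completionTrace_hasBasis p).mem_iff.1 hUV
    obtain ⟨δ, hδ, H⟩ := h.exists_le_dist (lipschitzWith_dist_completion p) hr hU hV hd hsub
    have hex : ∀ W ∉ completionTrace p, ∃ z : X,
        dist (z : UniformSpace.Completion X) p < min r (δ / 2) ∧ z ∉ W := by
      intro W hW
      by_contra! hcon
      exact hW ((completionTrace_hasBasis p).mem_iff.2 ⟨min r (δ / 2), by positivity, hcon⟩)
    obtain ⟨w, hw, hwU⟩ := hex U hn.1
    obtain ⟨z, hz, hzV⟩ := hex V hn.2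
    rw [lt_min_iff] at hw hz
    have hdist := H z ((hsub hz.1).resolve_right hzV) w ((hsub hw.1).resolve_left hwU)
      (by linarith)
    rw [← UniformSpace.Completion.dist_eq] at hdist
    linarith [dist_triangle_right (z : UniformSpace.Completion X) w p]

/-- In every sequence of pairs of points at distance tending to zero, the pairs separated in balls
of a fixed radius form a totally bounded set. -/
def HasTotallyBoundedSeparation (X : Type*) [MetricSpace X] : Prop :=
  ∀ r > 0, ∀ x y : ℕ → X, Tendsto (fun k => dist (x k) (y k)) atTop (𝓝 0) →
    TotallyBounded (x '' {k | IsBallSeparated r (x k) (y k)})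

/-- Otherwise infinitely many separated pairs sit in pairwise disjoint balls of a fixed radius.
Their partitions glue to one partition of a sublevel set of the distance to the centres, with points
of both sides arbitrarily close. -/
theorem IsStraight.hasTotallyBoundedSeparation (h : IsStraight X) :
    HasTotallyBoundedSeparation X := by
  intro r hr x y hxy
  by_contra hn
  obtain ⟨ε, hε, u, hu, hsep⟩ := exists_seq_of_not_totallyBounded hn
  choose κ hκ hκu using hu
  have hκinj : Function.Injective κ := fun m n hmn => by
    by_contra hne
    have := hsep m n hne
    rw [← hκu m, ← hκu n, hmn, dist_self] at this
    linarith
  choose U V hU hV hd hUV hxU hyV using hκ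
  obtain ⟨ρ, hρ, hρε, hρr⟩ : ∃ ρ > 0, 2 * ρ ≤ ε ∧ ρ ≤ r :=
    ⟨min (ε / 2) r, by positivity, by linarith [min_le_left (ε / 2) r], min_le_right _ _⟩
  have huniq : ∀ m n z, z ∈ Metric.ball (u m) ρ → z ∈ Metric.ball (u n) ρ → m = n := by
    intro m n z hm hn
    by_contra hne
    have h1 := hsep m n hne
    rw [Metric.mem_ball] at hm hn
    linarith [dist_triangle_left (u m) (u n) z]
  obtain ⟨δ, hδ, H⟩ := h.exists_le_dist (g := fun z => Metric.infDist z (range u)) (r := ρ)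
    (U := ⋃ n, U n ∩ Metric.ball (u n) ρ) (V := ⋃ n, V n ∩ Metric.ball (u n) ρ)
    (Metric.lipschitz_infDist_pt _) hρ (isOpen_iUnion fun n => (hU n).inter Metric.isOpen_ball)
    (isOpen_iUnion fun n => (hV n).inter Metric.isOpen_ball)
    (by
      refine disjoint_left.2 fun z hz hz' => ?_
      obtain ⟨m, hm, hm'⟩ := mem_iUnion.1 hz
      obtain ⟨n, hn, hn'⟩ := mem_iUnion.1 hz'
      obtain rfl := huniq m n z hm' hn'
      exact disjoint_left.1 (hd m) hm hn)
    (by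
      intro z hz
      obtain ⟨-, ⟨n, rfl⟩, hzn⟩ := (Metric.infDist_lt_iff (range_nonempty u)).1 hz
      have hz' : z ∈ Metric.ball (x (κ n)) r := by
        rw [hκu]
        exact Metric.ball_subset_ball hρr hzn
      exact (hUV n hz').imp (fun h => mem_iUnion.2 ⟨n, h, hzn⟩)
        (fun h => mem_iUnion.2 ⟨n, h, hzn⟩))
  have hlim := hxy.comp hκinj.nat_tendsto_atTop
  obtain ⟨n, hn⟩ := (hlim.eventually (gt_mem_nhds (lt_min hδ hρ))).exists
  simp only [Function.comp_apply, lt_min_iff] at hn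
  refine absurd (H (x (κ n)) (mem_iUnion.2 ⟨n, hxU n, ?_⟩) (y (κ n))
    (mem_iUnion.2 ⟨n, hyV n, ?_⟩) ?_) (not_le.2 hn.1)
  · rw [hκu]
    exact Metric.mem_ball_self hρ
  · rw [← hκu, Metric.mem_ball, dist_comm]
    exact hn.2
  · rw [hκu, Metric.infDist_zero_of_mem (mem_range_self n)]
    exact hδ

/-- If a function oscillates by less than `η` on each of `m` sets covering `A`, then its values on
`A` leave gaps in every interval of length `(m + 2) * η`. -/
theorem exists_notMem_image_of_cover {α : Type*} {m : ℕ} {f : α → ℝ} {C : Fin m → Set α}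
    {A : Set α} (hC : A ⊆ ⋃ k, C k) {η : ℝ} (hη : 0 < η)
    (hf : ∀ k, ∀ z ∈ A ∩ C k, ∀ w ∈ A ∩ C k, dist (f z) (f w) < η) {a b : ℝ}
    (hab : a + (m + 2) * η ≤ b) : ∃ c, a < c ∧ c < b ∧ c ∉ f '' A := by
  by_contra! hcon
  -- The `m + 1` values at spacing `η` are interior to the interval; two of them would be attained
  -- in the same `C k`.
  have hpt : ∀ j : Fin (m + 1), ∃ k, ∃ z ∈ A ∩ C k, f z = a + (j + 1) * η := by
    intro j
    have hj : (j : ℝ) ≤ m := by exact_mod_cast Nat.lt_succ_iff.1 j.2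
    obtain ⟨z, hz, hfz⟩ := hcon (a + (j + 1) * η) (by have : 0 ≤ (j : ℝ) := by positivity
                                                      nlinarith) (by nlinarith)
    obtain ⟨k, hk⟩ := mem_iUnion.1 (hC hz)
    exact ⟨k, z, ⟨hz, hk⟩, hfz⟩
  choose k z hz hfz using hpt
  obtain ⟨i, j, hij, hk⟩ := Fintype.exists_ne_map_eq_of_card_lt k (by simp)
  have hdist := hf (k i) (z i) (hz i) (z j) (hk ▸ hz j)
  rw [hfz, hfz, Real.dist_eq, show a + ((i : ℝ) + 1) * η - (a + ((j : ℝ) + 1) * η) =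
    ((i : ℝ) - j) * η by ring, abs_mul, abs_of_pos hη] at hdist
  have h1 : (1 : ℝ) ≤ |(i : ℝ) - j| := by
    have h2 : (1 : ℤ) ≤ |((i : ℕ) : ℤ) - ((j : ℕ) : ℤ)| :=
      Int.one_le_abs (sub_ne_zero.2 fun h => hij (Fin.ext (by exact_mod_cast h)))
    exact_mod_cast h2
  nlinarith

theorem isBallSeparated_of_notMem_image {f : X → ℝ} (hf : Continuous f) {r c : ℝ} {x y : X}
    (hc : c ∉ f '' Metric.ball x r) (h : f x < c ∧ c < f y ∨ f y < c ∧ c < f x) :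
    IsBallSeparated r x y := by
  have hlt : IsOpen {z | f z < c} := isOpen_lt hf continuous_const
  have hgt : IsOpen {z | c < f z} := isOpen_lt continuous_const hf
  have hd : Disjoint {z | f z < c} {z | c < f z} :=
    disjoint_left.2 fun z (h1 : f z < c) (h2 : c < f z) => lt_asymm h1 h2
  have hcov : Metric.ball x r ⊆ {z | f z < c} ∪ {z | c < f z} := fun z hz =>
    lt_or_gt_of_ne fun h => hc ⟨z, hz, h⟩
  rcases h with h | h
  · exact ⟨_, _, hlt, hgt, hd, hcov, h.1, h.2⟩
  · exact ⟨_, _, hgt, hlt, hd.symm, union_comm _ _ ▸ hcov, h.2, h.1⟩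

/-- If uniform continuity fails on close pairs, `f` skips a value between the two values of each
pair on a small ball. So the pairs are separated, their points are totally bounded, and along an
ultrafilter they converge to some `p` in the completion. Near `p` the function again skips a value
between the two limits, against tightness. -/
theorem IsStraight.of_isTight (ht : ∀ p : UniformSpace.Completion X, IsTight (completionTrace p))
    (hs : HasTotallyBoundedSeparation X) : IsStraight X := by
  intro m C hC hCU f
  refine ⟨fun h k => h.uniformContinuousOn, fun h => ?_⟩
  by_contra hnot
  rw [Metric.uniformContinuous_iff] at hnot
  push Not at hnot
  obtain ⟨ε, hε, hnot⟩ := hnot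
  have hpairs : ∀ k : ℕ, ∃ x y, dist x y < 1 / ((k : ℝ) + 1) ∧ ε ≤ dist (f x) (f y) := fun k =>
    hnot (1 / ((k : ℝ) + 1)) (by positivity)
  choose x y hxy hfxy using hpairs
  have hlim : Tendsto (fun k => dist (x k) (y k)) atTop (𝓝 0) :=
    squeeze_zero (fun k => dist_nonneg) (fun k => (hxy k).le) tendsto_one_div_add_atTop_nhds_zero_nat
  obtain ⟨η, hη, hηε⟩ : ∃ η > 0, (m + 2) * η = ε :=
    ⟨ε / (m + 2), by positivity, by field_simp⟩
  obtain ⟨r, hr, hosc⟩ : ∃ r > 0, ∀ A : Set X, (∀ z ∈ A, ∀ w ∈ A, dist z w < 2 * r) →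
      ∀ k, ∀ z ∈ A ∩ C k, ∀ w ∈ A ∩ C k, dist (f z) (f w) < η := by
    have := fun k => Metric.uniformContinuousOn_iff.1 (h k) η hη
    choose δ hδ H using this
    obtain ⟨δ₀, hδ₀, hle⟩ : ∃ δ₀ > 0, ∀ k, δ₀ ≤ δ k := by
      rcases isEmpty_or_nonempty (Fin m) with he | he
      · exact ⟨1, one_pos, fun k => he.elim k⟩
      · obtain ⟨k₀, hk₀⟩ := Finite.exists_min δ
        exact ⟨δ k₀, hδ k₀, hk₀⟩
    exact ⟨δ₀ / 2, by positivity, fun A hA k z hz w hw =>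
      H k z hz.2 w hw.2 (by linarith [hA z hz.1 w hw.1, hle k])⟩
  have hcov : ∀ A : Set X, A ⊆ ⋃ k, C k := fun A => hCU ▸ subset_univ A
  have hsep : ∀ k, IsBallSeparated r (x k) (y k) := by
    intro k
    have hb : ∀ z ∈ Metric.ball (x k) r, ∀ w ∈ Metric.ball (x k) r, dist z w < 2 * r := by
      intro z hz w hw
      rw [Metric.mem_ball] at hz hw
      linarith [dist_triangle_right z w (x k)]
    have hgap := fun a b => exists_notMem_image_of_cover (hcov _) hη (hosc _ hb) (a := a) (b := b)
    have hk := hfxy k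
    rw [Real.dist_eq, le_abs] at hk
    rcases hk with hk | hk
    · obtain ⟨c, h1, h2, h3⟩ := hgap (f (y k)) (f (x k)) (by linarith)
      exact isBallSeparated_of_notMem_image f.continuous h3 (Or.inr ⟨h1, h2⟩)
    · obtain ⟨c, h1, h2, h3⟩ := hgap (f (x k)) (f (y k)) (by linarith)
      exact isBallSeparated_of_notMem_image f.continuous h3 (Or.inl ⟨h1, h2⟩)
  have hTB : TotallyBounded (range x) := by
    have := hs r hr x y hlim
    rwa [show {k | IsBallSeparated r (x k) (y k)} = univ from eq_univ_of_forall hsep,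
      image_univ] at this
  let 𝒢 : Ultrafilter ℕ := hyperfilter ℕ
  have h𝒢 : (𝒢 : Filter ℕ) ≤ atTop := Nat.hyperfilter_le_atTop
  have hcx : Cauchy (map x (𝒢 : Filter ℕ)) := cauchy_map_hyperfilter hTB
  obtain ⟨p, hp⟩ := CompleteSpace.complete
    (hcx.map (UniformSpace.Completion.uniformContinuous_coe X))
  rw [map_map] at hp
  have hxp : Tendsto x 𝒢 (completionTrace p) := tendsto_comap_iff.2 hp
  have hyp : Tendsto y 𝒢 (completionTrace p) := by
    refine tendsto_comap_iff.2 ?_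
    have hp' : Tendsto (fun k => (x k : UniformSpace.Completion X)) 𝒢 (𝓝 p) := hp
    refine hp'.congr_dist ?_
    simpa only [Function.comp_apply, UniformSpace.Completion.dist_eq] using hlim.mono_left h𝒢
  have hcy : Cauchy (map y (𝒢 : Filter ℕ)) := by
    refine (Cauchy.comap (cauchy_nhds (a := p)) ?_).mono hyp
    exact (UniformSpace.Completion.isUniformInducing_coe X).comap_uniformity.le
  have hconv : ∀ u : ℕ → X, Cauchy (map u (𝒢 : Filter ℕ)) →
      ∃ a, Tendsto (fun k => f (u k)) 𝒢 (𝓝 a) := by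
    intro u hu
    -- An ultrafilter picks one of the finitely many closed sets, and uniform continuity there
    -- preserves Cauchy filters.
    obtain ⟨k, hk⟩ : ∃ k, C k ∈ 𝒢.map u := by
      refine Ultrafilter.eventually_exists_iff.1 (Eventually.of_forall fun z => ?_)
      exact mem_iUnion.1 (hCU ▸ mem_univ z)
    exact CompleteSpace.complete (hu.map_of_le (h k) (le_principal_iff.2 hk))
  obtain ⟨a, ha⟩ := hconv x hcx
  obtain ⟨b, hb⟩ := hconv y hcy
  have hab : ε ≤ dist a b := ge_of_tendsto' (ha.dist hb) hfxy
  let A : Set X := {z | dist (z : UniformSpace.Completion X) p < r}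
  have hA : A ∈ completionTrace p := (completionTrace_hasBasis p).mem_of_mem hr
  have hAd : ∀ z ∈ A, ∀ w ∈ A, dist z w < 2 * r := by
    intro z hz w hw
    rw [← UniformSpace.Completion.dist_eq]
    have h1 : dist (z : UniformSpace.Completion X) p < r := hz
    have h2 : dist (w : UniformSpace.Completion X) p < r := hw
    linarith [dist_triangle_right (z : UniformSpace.Completion X) w p]
  have key : ∀ (u v : ℕ → X) (a b : ℝ), Tendsto u 𝒢 (completionTrace p) →
      Tendsto v 𝒢 (completionTrace p) → Tendsto (fun k => f (u k)) 𝒢 (𝓝 a) →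
      Tendsto (fun k => f (v k)) 𝒢 (𝓝 b) → a + ε ≤ b → False := by
    intro u v a b hu hv ha hb hab
    obtain ⟨c, hac, hcb, hc⟩ := exists_notMem_image_of_cover (hcov A) hη (hosc A hAd)
      (a := a) (b := b) (by linarith)
    rcases (ht p).split {z | f z < c} {z | c < f z} (isOpen_lt f.continuous continuous_const)
      (isOpen_lt continuous_const f.continuous)
      (disjoint_left.2 fun z (h1 : f z < c) (h2 : c < f z) => lt_asymm h1 h2)
      (mem_of_superset hA fun z hz => lt_or_gt_of_ne fun h => hc ⟨z, hz, h⟩) with h | h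
    · obtain ⟨k, h1, h2⟩ := ((hv.eventually h).and (hb.eventually (lt_mem_nhds hcb))).exists
      exact lt_asymm (id h1 : f (v k) < c) h2
    · obtain ⟨k, h1, h2⟩ := ((hu.eventually h).and (ha.eventually (gt_mem_nhds hac))).exists
      exact lt_asymm (id h1 : c < f (u k)) h2
  rw [Real.dist_eq, le_abs] at hab
  rcases hab with hab | hab
  · exact key y x b a hyp hxp hb ha (by linarith)
  · exact key x y a b hxp hyp ha hb (by linarith)

end Straight

/-! ### Finite products with the sum metric. -/

section Product

variable {n : ℕ} {X : Fin n → Type*} [∀ i, MetricSpace (X i)]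

theorem piLp_one_dist_eq_sum (x y : PiLp 1 X) : dist x y = ∑ i, dist (x i) (y i) := by
  rw [PiLp.dist_eq_sum (by simp)]
  simp

theorem dist_apply_le_piLp_one (x y : PiLp 1 X) (i : Fin n) : dist (x i) (y i) ≤ dist x y := by
  rw [piLp_one_dist_eq_sum]
  exact Finset.single_le_sum (f := fun i => dist (x i) (y i)) (fun _ _ => dist_nonneg)
    (Finset.mem_univ i)

theorem uniformContinuous_piLp_one_apply (i : Fin n) :
    UniformContinuous fun x : PiLp 1 X => x i :=
  (LipschitzWith.of_dist_le_mul (K := 1) fun x y => by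
    simpa using dist_apply_le_piLp_one x y i).uniformContinuous

theorem dist_toLp_update (x : PiLp 1 X) (i : Fin n) (v w : X i) :
    dist (WithLp.toLp 1 (Function.update x.ofLp i v) : PiLp 1 X)
      (WithLp.toLp 1 (Function.update x.ofLp i w)) = dist v w := by
  rw [piLp_one_dist_eq_sum, Finset.sum_eq_single i]
  · simp
  · intro j _ hj
    simp [hj]
  · simp

theorem continuous_toLp_update (x : PiLp 1 X) (i : Fin n) :
    Continuous fun v : X i => (WithLp.toLp 1 (Function.update x.ofLp i v) : PiLp 1 X) :=
  (PiLp.continuous_toLp 1 X).comp (continuous_const.update i continuous_id)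

theorem dist_completion_piLp_one (z : PiLp 1 X) (p : UniformSpace.Completion (PiLp 1 X)) :
    dist (z : UniformSpace.Completion (PiLp 1 X)) p = ∑ i, dist (z i : UniformSpace.Completion (X i))
      (UniformSpace.Completion.map (fun x : PiLp 1 X => x i) p) := by
  induction p using UniformSpace.Completion.induction_on with
  | hp =>
    refine isClosed_eq (by fun_prop) (continuous_finsetSum _ fun i _ => ?_)
    exact continuous_const.dist UniformSpace.Completion.continuous_map
  | ih w =>
    rw [UniformSpace.Completion.dist_eq, piLp_one_dist_eq_sum]
    refine Finset.sum_congr rfl fun i _ => ?_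
    rw [UniformSpace.Completion.map_coe (uniformContinuous_piLp_one_apply i),
      UniformSpace.Completion.dist_eq]

theorem completionTrace_piLp_one (p : UniformSpace.Completion (PiLp 1 X)) :
    completionTrace p = map (PiLp.homeomorph 1 X).symm (Filter.pi fun i =>
      completionTrace (UniformSpace.Completion.map (fun x : PiLp 1 X => x i) p)) := by
  apply le_antisymm
  · have h : Tendsto (PiLp.homeomorph 1 X) (completionTrace p) (Filter.pi fun i =>
        completionTrace (UniformSpace.Completion.map (fun x : PiLp 1 X => x i) p)) := by
      refine tendsto_pi.2 fun i => tendsto_comap_iff.2 ?_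
      have : Tendsto (fun x : PiLp 1 X => UniformSpace.Completion.map (fun x : PiLp 1 X => x i)
          (x : UniformSpace.Completion (PiLp 1 X))) (completionTrace p)
          (𝓝 (UniformSpace.Completion.map (fun x : PiLp 1 X => x i) p)) :=
        (UniformSpace.Completion.continuous_map.tendsto p).comp tendsto_comap
      refine this.congr fun x => ?_
      rw [UniformSpace.Completion.map_coe (uniformContinuous_piLp_one_apply i)]
      rfl
    have := map_mono (m := (PiLp.homeomorph 1 X).symm) h
    rwa [map_map, Homeomorph.symm_comp_self, map_id] at this
  · refine (completionTrace_hasBasis p).ge_iff.2 fun ε hε => ?_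
    have hn : 0 < ε / (n + 1) := by positivity
    have h := eventually_pi fun i => (completionTrace_hasBasis
      (UniformSpace.Completion.map (fun x : PiLp 1 X => x i) p)).eventually_iff.2
        ⟨ε / (n + 1), hn, fun x hx => hx⟩
    refine mem_map.2 (mem_of_superset h fun x (hx : ∀ i, _ < ε / (n + 1)) => ?_)
    change dist ((PiLp.homeomorph 1 X).symm x : UniformSpace.Completion (PiLp 1 X)) p < ε
    rw [dist_completion_piLp_one]
    refine (Finset.sum_le_sum fun i _ => (hx i).le).trans_lt ?_
    rw [Finset.sum_const, Finset.card_univ, Fintype.card_fin, nsmul_eq_mul, mul_div_assoc',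
      div_lt_iff₀ (by positivity)]
    nlinarith

theorem isTight_completionTrace_piLp_one
    (h : ∀ i, ∀ p : UniformSpace.Completion (X i), IsTight (completionTrace p))
    (p : UniformSpace.Completion (PiLp 1 X)) : IsTight (completionTrace p) := by
  rw [completionTrace_piLp_one]
  exact (IsTight.pi fun i => h i _).map_homeomorph _

theorem TotallyBounded.piLp_one {s : Set (PiLp 1 X)}
    (h : ∀ i, TotallyBounded ((fun x : PiLp 1 X => x i) '' s)) : TotallyBounded s := by
  rw [totallyBounded_iff_ultrafilter]
  intro f hf
  have hc : Cauchy (map WithLp.ofLp (f : Filter (PiLp 1 X))) := by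
    refine (cauchy_pi_iff' X).2 fun i => ?_
    refine (f.map fun x : PiLp 1 X => x i).cauchy_of_totallyBounded (h i) (le_principal_iff.2 ?_)
    exact image_mem_map (le_principal_iff.1 hf)
  have := hc.map (PiLp.uniformContinuous_toLp 1 X)
  rwa [map_map, show (WithLp.toLp 1 ∘ WithLp.ofLp : PiLp 1 X → PiLp 1 X) = id from rfl, map_id]
    at this

/-- Two points of a product separated in a ball have a coordinate in which they are separated. -/
theorem IsBallSeparated.exists_apply {r : ℝ} {x y : PiLp 1 X} (h : IsBallSeparated r x y)
    (hxy : dist x y < r / 2) : ∃ i, IsBallSeparated (r / 2) (x i) (y i) := by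
  obtain ⟨U, V, hU, hV, hd, hUV, hxU, hyV⟩ := h
  -- Walk from `x` to `y` one coordinate at a time; the coordinate whose change enters `V` is the
  -- required one.
  let z : ℕ → PiLp 1 X := fun m => WithLp.toLp 1 fun i => if (i : ℕ) < m then y i else x i
  -- The coordinates other than `i` contribute at most `dist x y < r / 2`.
  have hz : ∀ m i (v : X i), dist v (x i) < r / 2 →
      WithLp.toLp 1 (Function.update (z m).ofLp i v) ∈ U ∪ V := by
    intro m i v hv
    refine hUV ?_
    rw [Metric.mem_ball]
    have h1 : dist (WithLp.toLp 1 (Function.update (z m).ofLp i v)) x ≤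
        dist v (x i) + dist x y := by
      rw [piLp_one_dist_eq_sum, piLp_one_dist_eq_sum,
        ← Finset.add_sum_erase _ _ (Finset.mem_univ i),
        ← Finset.add_sum_erase _ (fun j => dist (x j) (y j)) (Finset.mem_univ i)]
      have h2 : ∑ j ∈ Finset.univ.erase i, dist ((WithLp.toLp 1
          (Function.update (z m).ofLp i v) : PiLp 1 X) j) (x j) ≤
          ∑ j ∈ Finset.univ.erase i, dist (x j) (y j) := by
        refine Finset.sum_le_sum fun j hj => ?_
        have hji : j ≠ i := Finset.ne_of_mem_erase hj
        simp only [Function.update_of_ne hji, z]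
        split_ifs
        · rw [dist_comm]
        · rw [dist_self]
          exact dist_nonneg
      have h3 : dist ((WithLp.toLp 1 (Function.update (z m).ofLp i v) : PiLp 1 X) i) (x i) =
          dist v (x i) := by simp
      have h4 : 0 ≤ dist (x i) (y i) := dist_nonneg
      linarith
    linarith
  have hz0 : z 0 = x := by
    ext i
    simp [z]
  have hzn : z n = y := by
    ext i
    simp [z]
  obtain ⟨m, hmn, hm, hm'⟩ : ∃ m < n, z m ∉ V ∧ z (m + 1) ∈ V := by
    by_contra! hcon
    have : ∀ m ≤ n, z m ∉ V := by
      intro m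
      induction m with
      | zero => exact fun _ h => disjoint_left.1 hd hxU (hz0 ▸ h)
      | succ m ih => exact fun hm => hcon m hm (ih (by omega))
    exact this n le_rfl (hzn ▸ hyV)
  let i : Fin n := ⟨m, hmn⟩
  have hx : z m = WithLp.toLp 1 (Function.update (z m).ofLp i (x i)) := by
    ext j
    by_cases hj : j = i
    · subst hj
      simp [z, i]
    · simp [hj]
  have hy : z (m + 1) = WithLp.toLp 1 (Function.update (z m).ofLp i (y i)) := by
    ext j
    by_cases hj : j = i
    · subst hj
      simp [z, i]
    · have : (j : ℕ) ≠ m := fun h => hj (Fin.ext h)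
      have h2 : (j : ℕ) < m + 1 ↔ (j : ℕ) < m := by omega
      simp [hj, z, h2]
  have hr : 0 < r / 2 := dist_nonneg.trans_lt hxy
  have hc := continuous_toLp_update (z m) i
  refine ⟨i, _, _, hU.preimage hc, hV.preimage hc, hd.preimage _, fun v hv => hz m i v hv, ?_, ?_⟩
  · exact (hz m i (x i) (by rwa [dist_self])).resolve_right (hx ▸ hm)
  · exact (hy ▸ hm' :)

theorem IsBallSeparated.of_apply {r : ℝ} {x y : PiLp 1 X} {i : Fin n}
    (h : IsBallSeparated r (x i) (y i)) : IsBallSeparated r x y := by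
  obtain ⟨U, V, hU, hV, hd, hUV, hxU, hyV⟩ := h
  have hc : Continuous fun x : PiLp 1 X => x i := (uniformContinuous_piLp_one_apply i).continuous
  exact ⟨_, _, hU.preimage hc, hV.preimage hc, hd.preimage _,
    fun z hz => hUV ((dist_apply_le_piLp_one z x i).trans_lt hz), hxU, hyV⟩

/-- For a ULC factor only finitely many pairs are separated in that coordinate. For any other factor
`i`, all the remaining factors are precompact, and coordinate `i` is controlled by `h i`. -/
theorem hasTotallyBoundedSeparation_piLp_one (h : ∀ i, HasTotallyBoundedSeparation (X i))
    (hpair : ∀ i j, i ≠ j → IsPrecompactSpace (X i) ∨ IsULC (X j)) :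
    HasTotallyBoundedSeparation (PiLp 1 X) := by
  intro r hr x y hxy
  have hxyi : ∀ i, Tendsto (fun k => dist (x k i) (y k i)) atTop (𝓝 0) := fun i =>
    squeeze_zero (fun _ => dist_nonneg) (fun k => dist_apply_le_piLp_one _ _ i) hxy
  obtain ⟨K, hK⟩ := eventually_atTop.1 (hxy.eventually (gt_mem_nhds (half_pos hr)))
  have hsub : x '' {k | IsBallSeparated r (x k) (y k)} ⊆ x '' Iio K ∪
      ⋃ i, x '' {k | IsBallSeparated (r / 2) (x k i) (y k i)} := by
    rintro _ ⟨k, hk, rfl⟩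
    rcases lt_or_ge k K with hkK | hkK
    · exact Or.inl ⟨k, hkK, rfl⟩
    · obtain ⟨i, hi⟩ := IsBallSeparated.exists_apply hk (hK k hkK)
      exact Or.inr (mem_iUnion.2 ⟨i, k, hi, rfl⟩)
  refine TotallyBounded.subset hsub (((finite_Iio K).image x).totallyBounded.union
    (totallyBounded_iUnion.2 fun i => ?_))
  by_cases hi : IsULC (X i)
  · obtain ⟨δ, hδ, H⟩ := hi.exists_not_isBallSeparated (half_pos hr)
    obtain ⟨M, hM⟩ := eventually_atTop.1 ((hxyi i).eventually (gt_mem_nhds hδ))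
    refine (((finite_Iio M).subset fun k hk => ?_).image x).totallyBounded
    by_contra hkM
    exact H _ _ (hM k (not_lt.1 hkM)) hk
  · refine TotallyBounded.piLp_one fun j => ?_
    rw [image_image]
    by_cases hj : j = i
    · subst hj
      exact h j (r / 2) (half_pos hr) _ _ (hxyi j)
    · exact TotallyBounded.subset (subset_univ _) ((hpair j i hj).resolve_right hi)

variable [∀ i, Nonempty (X i)]

theorem IsStraight.of_piLp_one (h : IsStraight (PiLp 1 X)) (i : Fin n) : IsStraight (X i) := by
  intro m C hC hCU f
  refine ⟨fun h k => h.uniformContinuousOn, fun hf => ?_⟩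
  have hp := uniformContinuous_piLp_one_apply (X := X) i
  have huc : UniformContinuous fun x : PiLp 1 X => f (x i) := by
    refine (h m (fun k => (fun x : PiLp 1 X => x i) ⁻¹' C k)
      (fun k => (hC k).preimage hp.continuous) ?_ ⟨_, f.continuous.comp hp.continuous⟩).2
      fun k => ?_
    · rw [← preimage_iUnion, hCU, preimage_univ]
    · exact (hf k).comp hp.uniformContinuousOn fun _ hx => hx
  let x₀ : PiLp 1 X := WithLp.toLp 1 fun i => Classical.arbitrary (X i)
  have hs : UniformContinuous fun v : X i =>
      (WithLp.toLp 1 (Function.update x₀.ofLp i v) : PiLp 1 X) :=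
    (Isometry.of_dist_eq (dist_toLp_update x₀ i)).uniformContinuous
  simpa [Function.comp_def] using huc.comp hs

/-- Otherwise close separated pairs in `X j`, placed over a uniformly separated sequence in `X i`,
give separated pairs that are not totally bounded. -/
theorem HasTotallyBoundedSeparation.isPrecompactSpace_or_isULC
    (h : HasTotallyBoundedSeparation (PiLp 1 X)) {i j : Fin n} (hij : i ≠ j) :
    IsPrecompactSpace (X i) ∨ IsULC (X j) := by
  by_contra! hn
  obtain ⟨hP, hQ⟩ := hn
  obtain ⟨ε, hε, a, -, ha⟩ := exists_seq_of_not_totallyBounded hP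
  have hsep : ∃ r > 0, ∀ δ > 0, ∃ x y : X j, dist x y < δ ∧ IsBallSeparated r x y := by
    by_contra! hcon
    exact hQ (IsULC.of_not_isBallSeparated hcon)
  obtain ⟨r, hr, hsep⟩ := hsep
  have hpairs := fun k : ℕ => hsep (1 / ((k : ℝ) + 1)) (by positivity)
  choose x y hxy hs using hpairs
  let x₀ : PiLp 1 X := WithLp.toLp 1 fun i => Classical.arbitrary (X i)
  let b : ℕ → PiLp 1 X := fun k => WithLp.toLp 1 (Function.update x₀.ofLp i (a k))
  let x' : ℕ → PiLp 1 X := fun k => WithLp.toLp 1 (Function.update (b k).ofLp j (x k))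
  let y' : ℕ → PiLp 1 X := fun k => WithLp.toLp 1 (Function.update (b k).ofLp j (y k))
  have hlim : Tendsto (fun k => dist (x' k) (y' k)) atTop (𝓝 0) := by
    refine squeeze_zero (fun _ => dist_nonneg) (fun k => ?_)
      tendsto_one_div_add_atTop_nhds_zero_nat
    exact (dist_toLp_update (b k) j (x k) (y k)).trans_le (hxy k).le
  have hs' : ∀ k, IsBallSeparated r (x' k) (y' k) := fun k =>
    IsBallSeparated.of_apply (i := j) (by simpa [x', y'] using hs k)
  have hTB := (h r hr x' y' hlim).image (uniformContinuous_piLp_one_apply i)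
  rw [show {k | IsBallSeparated r (x' k) (y' k)} = univ from eq_univ_of_forall hs', image_univ,
    ← range_comp] at hTB
  refine not_totallyBounded_range hε ha ?_
  convert hTB using 2
  ext k
  simp [x', b, hij]

end Product

/-! ### The pairwise criterion and the conclusion. -/

theorem forall_ne_or_iff {ι : Type*} (P Q : ι → Prop) :
    (∀ i j, i ≠ j → P i ∨ Q j) ↔ (∀ i, P i) ∨ (∀ i, Q i) ∨ ∃ j, ∀ i, i ≠ j → P i ∧ Q i := by
  constructor
  · intro h
    by_contra! hn
    obtain ⟨⟨i, hi⟩, ⟨j, hj⟩, hn⟩ := hn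
    have hij : j = i := by
      by_contra hne
      exact hj ((h i j (Ne.symm hne)).resolve_left hi)
    subst hij
    obtain ⟨k, hk, hkn⟩ := hn j
    exact hkn ((h k j hk).resolve_right hj) ((h j k hk.symm).resolve_left hi)
  · rintro (h | h | ⟨k, h⟩) i j hij
    · exact Or.inl (h i)
    · exact Or.inr (h j)
    · by_cases hi : i = k
      · exact Or.inr (h j (hi ▸ hij.symm)).2
      · exact Or.inl (h i hi).1

/-- The product carries the sum metric `d(x, y) = ∑ i, d_i(x i, y i)`, i.e. it is `PiLp 1 X`. -/
theorem corollary1 {n : ℕ} (X : Fin n → Type*) [∀ i, MetricSpace (X i)] [∀ i, Nonempty (X i)] :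
    IsStraight (PiLp 1 X) ↔
      (∀ i, IsStraight (X i)) ∧
        ((∀ i, IsPrecompactSpace (X i)) ∨
          (∀ i, IsULC (X i)) ∨
          (∃ j, ∀ i, i ≠ j → IsPrecompactSpace (X i) ∧ IsULC (X i))) := by
  rw [← forall_ne_or_iff (fun i => IsPrecompactSpace (X i)) fun i => IsULC (X i)]
  refine ⟨fun h => ⟨h.of_piLp_one, fun i j hij =>
    h.hasTotallyBoundedSeparation.isPrecompactSpace_or_isULC hij⟩, fun ⟨h, hpair⟩ => ?_⟩
  exact IsStraight.of_isTight
    (isTight_completionTrace_piLp_one fun i => (h i).isTight_completionTrace)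
    (hasTotallyBoundedSeparation_piLp_one (fun i => (h i).hasTotallyBoundedSeparation) hpair)
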